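/- Let $\overline{\mathbb Q}$ be a fixed algebraic closure of $\mathbb Q$ and let $Y$ be the set of all places $y$ of $\overline{\mathbb Q}$; for $y\in Y$ let $\|\cdot\|_y$ be the absolute value in $y$ whose restriction to $\mathbb Q$ is the usual archimedean or a usual $p$-adic absolute value. For a number field $k\subseteq\overline{\mathbb Q}$ and a place $v$ of $k$ put $Y(k,v)=\{y\in Y: y\mid v\}$; the sets $Y(k,v)$ form a basis of the (locally compact, totally disconnected, Hausdorff) topology of $Y$. Let $\mathrm{Aut}(\overline{\mathbb Q}/\mathbb Q)$ act on $Y$ by $\|x\|_{\tau y}=\|\tau^{-1}x\|_y$, and let $\lambda$ be the $\mathrm{Aut}(\overline{\mathbb Q}/\mathbb Q)$-invariant Borel measure on $Y$ with $\lambda(Y(\mathbb Q,u))=1$ for every place $u$ of $\mathbb Q$ (equivalently, $\lambda(Y(k,v))=[k_v:\mathbb Q_v]/[k:\mathbb Q]$ for every finite Galois extension $k/\mathbb Q$ and every place $v$ of $k$). Let $$\mathcal X=\Big\{F\in L^1(Y,\lambda): \int_Y F\,d\lambda=0\Big\}$$ with the $L^1$-norm. For $\alpha\in\overline{\mathbb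 Q}^\times$ let $f_\alpha(y)=\log\|\alpha\|_y$, which is an element of $\mathcal X$, and let $\mathcal F=\{f_\alpha:\alpha\in\overline{\mathbb Q}^\times\}$, a $\mathbb Q$-linear subspace of $\mathcal X$. A subset $\mathcal S\subseteq\mathcal F$ is called $\mathcal F$-closed if $\mathcal S=\mathcal F\cap\overline{\mathcal S}$, where $\overline{\mathcal S}$ is the closure of $\mathcal S$ in $\mathcal X$. For a field $K$ with $\mathbb Q\subseteq K\subseteq\overline{\mathbb Q}$ let $\nu_K$ be the Haar measure of total mass $1$ on the compact group $\mathrm{Aut}(\overline{\mathbb Q}/K)$ and let $U_K:\mathcal X\to\mathcal X$ be the linear operator $$U_K(F)(y)=\int_{\mathrm{Aut}(\overline{\mathbb Q}/K)}F(\tau^{-1}y)\,d\nu_K(\tau)\qquad\text{for $\lambda$-almost all } y.$$ Let $S_K$ be the restriction of $U_K$ to $\mathcal F$, let $\mathcal E_K=\ker S_K\subseteq\mathcal F$, and let $\mathcal D_K$ be the $\mathbb Q$-linear span of $\{f_\beta:\beta\in K^\times\}$. **Theorem.** Let $K_1,K_2,\dots,K_N$ be fields with $\mathbb Q\subseteq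 K_n\subseteq\overline{\mathbb Q}$ such that, for each pair $n_1\neq n_2$, at least one of $K_{n_1}/(K_{n_1}\cap K_{n_2})$ and $K_{n_2}/(K_{n_1}\cap K_{n_2})$ is a (possibly infinite) Galois extension. Then for every integer $M$ with $0\le M\le N$ the $\mathbb Q$-linear subspace $$\mathcal D_{K_1}+\cdots+\mathcal D_{K_M}+\mathcal E_{K_{M+1}}+\cdots+\mathcal E_{K_N}$$ of $\mathcal F$ is $\mathcal F$-closed. -/

import Mathlib

namespace WeilHeight

noncomputable section

open MeasureTheory

/-- The fixed algebraic closure `ℚ̄` of `ℚ`. -/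
def Qbar : Type := AlgebraicClosure ℚ
instance : Field Qbar := inferInstanceAs (Field (AlgebraicClosure ℚ))
instance : CharZero Qbar := inferInstanceAs (CharZero (AlgebraicClosure ℚ))

instance : IsAlgClosure ℚ Qbar := by
  have e : (AlgebraicClosure.instAlgebra ℚ : Algebra ℚ (AlgebraicClosure ℚ)) =
    DivisionRing.toRatAlgebra := Subsingleton.elim _ _
  have h : @Algebra.IsAlgebraic ℚ (AlgebraicClosure ℚ) _ _ (AlgebraicClosure.instAlgebra ℚ) :=
    AlgebraicClosure.isAlgebraic ℚ
  rw [e] at h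
  exact ⟨inferInstanceAs (IsAlgClosed (AlgebraicClosure ℚ)), h⟩

instance : IsAlgClosed Qbar := IsAlgClosure.isAlgClosed ℚ
instance : Algebra.IsAlgebraic ℚ Qbar := IsAlgClosure.isAlgebraic
instance : IsGalois ℚ Qbar := IsAlgClosure.isGalois ℚ Qbar

instance : Countable Qbar := by
  have := Algebra.IsAlgebraic.cardinalMk_le_max ℚ Qbar
  rw [← Cardinal.mk_le_aleph0_iff]
  simpa using this

/-- The absolute Galois group `Aut(ℚ̄/ℚ)`, a compact group for the Krull topology. -/
abbrev GQ := Qbar ≃ₐ[ℚ] Qbar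

/-- The places of a field `k` (used for algebraic extensions `k` of `ℚ`). A place is an equivalence
class of nontrivial absolute values; it is represented here by its unique normalised member, the one
whose restriction to `ℚ` is the usual archimedean or a usual `p`-adic absolute value. So for
`y : Place k` the number `y.1 x` is `‖x‖_y`. -/
@[ext]
structure Place (k : Type*) [Field k] where
  toAbsoluteValue : AbsoluteValue k ℝ
  normalised : (∀ q : ℚ, toAbsoluteValue (q : k) = |(q : ℝ)|) ∨
    ∃ p : ℕ, p.Prime ∧ ∀ q : ℚ, toAbsoluteValue (q : k) = ((padicNorm p q : ℚ) : ℝ)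

theorem Place.exists_rat {k : Type*} [Field k] (v : Place k) :
    ∃ q : ℚ, q ≠ 0 ∧ v.1 (q : k) < 1 := by
  obtain h | ⟨p, hp, h⟩ := v.2
  · exact ⟨1 / 2, by norm_num, by rw [h]; norm_num [abs_of_pos]⟩
  · refine ⟨p, by exact_mod_cast hp.ne_zero, ?_⟩
    have : Fact p.Prime := ⟨hp⟩
    rw [h, padicNorm.padicNorm_p_of_prime]
    have := hp.one_lt
    push_cast
    exact inv_lt_one_of_one_lt₀ (by exact_mod_cast this)

theorem Place.eq_of_isEquiv {k : Type*} [Field k] [CharZero k] (v w : Place k)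
    (h : v.1.IsEquiv w.1) (hq : ∀ q : ℚ, v.1 (q : k) = w.1 q) : v = w := by
  obtain ⟨c, hc, hvw⟩ := AbsoluteValue.isEquiv_iff_exists_rpow_eq.1 h
  obtain ⟨q, hq0, hq1⟩ := v.exists_rat
  have hpos : 0 < v.1 (q : k) := v.1.pos (by exact_mod_cast hq0)
  have h1 := congrFun hvw (q : k)
  rw [← hq] at h1
  have hc1 : c = 1 := by
    have := (Real.rpow_right_inj hpos hq1.ne).1 (h1.trans (Real.rpow_one _).symm)
    exact this
  apply Place.ext
  ext x
  have := congrFun hvw x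
  simpa [hc1] using this

/-- A number field has only finitely many places with a given restriction to `ℚ`. -/
theorem Place.finite_setOf {k : Type*} [Field k] [CharZero k] [FiniteDimensional ℚ k]
    (v₀ : ℚ → ℝ) : {v : Place k | ∀ q : ℚ, v.1 (q : k) = v₀ q}.Finite := by
  by_contra hinf
  obtain ⟨t, hts, htc⟩ := (show Set.Infinite _ from hinf).exists_subset_card_eq
    (Module.finrank ℚ k + 1)
  let v : t → AbsoluteValue k ℝ := fun i => i.1.1
  have hval : ∀ i : t, ∀ q : ℚ, v i (q : k) = v₀ q := fun i => hts i.2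
  have hnt : ∀ i, (v i).IsNontrivial := fun i => by
    obtain ⟨q, h0, h1⟩ := i.1.exists_rat
    exact ⟨q, by exact_mod_cast h0, h1.ne⟩
  have hne : Pairwise fun i j => ¬ (v i).IsEquiv (v j) := by
    intro i j hij he
    exact hij (Subtype.ext (Place.eq_of_isEquiv i.1 j.1 he fun q =>
      (hval i q).trans (hval j q).symm))
  have hdense := AbsoluteValue.denseRange_algebraMap_pi hnt hne
  classical
  have hn : (0 : ℝ) < 1 / (2 * (t.card : ℝ)) := by rw [htc]; positivity
  have hb : ∀ i : t, ∃ b : k, ∀ j : t,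
      v j ((if j = i then 1 else 0) - b) < 1 / (2 * (t.card : ℝ)) := by
    intro i
    obtain ⟨b, hb⟩ := Metric.denseRange_iff.1 hdense
      (fun j => WithAbs.toAbs (v j) (if j = i then 1 else 0)) _ hn
    refine ⟨b, fun j => ?_⟩
    have := (dist_pi_lt_iff hn).1 hb j
    rw [dist_eq_norm] at this
    exact this
  choose b hb using hb
  have hli : ¬ LinearIndependent ℚ b := by
    intro hli
    have := hli.fintype_card_le_finrank
    rw [Fintype.card_coe, htc] at this
    omega
  obtain ⟨g, hg, i₁, hi₁⟩ := Fintype.not_linearIndependent_iff.1 hli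
  obtain ⟨i, -, hi⟩ := Finset.exists_max_image Finset.univ (fun i => v i₁ (g i : k))
    ⟨i₁, Finset.mem_univ _⟩
  have hvv : ∀ j q, v j ((q : ℚ) : k) = v i₁ (q : k) := fun j q =>
    (hval j q).trans (hval i₁ q).symm
  have hpos : 0 < v i₁ (g i : k) :=
    lt_of_lt_of_le ((v i₁).pos (by exact_mod_cast hi₁)) (hi i₁ (Finset.mem_univ _))
  have key : ((g i : ℚ) : k) = ∑ j, (g j : k) * ((if i = j then 1 else 0) - b j) := by
    simp only [mul_sub, Finset.sum_sub_distrib, mul_ite, mul_one, mul_zero]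
    have : ∑ j, (g j : k) * b j = 0 := by simpa [Rat.smul_def] using hg
    rw [this]; simp
  have : v i₁ (g i : k) ≤ v i₁ (g i : k) * (1 / 2) := by
    calc v i₁ (g i : k) = v i (g i : k) := (hvv i _).symm
      _ = v i (∑ j, (g j : k) * ((if i = j then 1 else 0) - b j)) := congrArg _ key
      _ ≤ ∑ j, v i ((g j : k) * ((if i = j then 1 else 0) - b j)) := (v i).sum_le _ _
      _ ≤ ∑ j : t, v i₁ (g i : k) * (1 / (2 * (t.card : ℝ))) := by
          refine Finset.sum_le_sum fun j _ => ?_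
          rw [map_mul, hvv]
          have h1 := hi j (Finset.mem_univ _)
          have h2 := (hb j i).le
          exact mul_le_mul h1 h2 ((v i).nonneg _) hpos.le
      _ = v i₁ (g i : k) * (1 / 2) := by
          rw [Finset.sum_const, Finset.card_univ, Fintype.card_coe, nsmul_eq_mul, htc]
          push_cast; field_simp
  linarith

theorem Place.countable (k : Type*) [Field k] [CharZero k] [FiniteDimensional ℚ k] :
    Countable (Place k) := by
  rw [← Set.countable_univ_iff]
  refine Set.Countable.mono (s₂ := {v : Place k | ∀ q : ℚ, v.1 (q : k) = |(q : ℝ)|} ∪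
    ⋃ p : ℕ, {v : Place k | ∀ q : ℚ, v.1 (q : k) = ((padicNorm p q : ℚ) : ℝ)}) ?_ ?_
  · rintro v -
    obtain h | ⟨p, -, h⟩ := v.2
    · exact Or.inl h
    · exact Or.inr (Set.mem_iUnion.2 ⟨p, h⟩)
  · exact (Place.finite_setOf _).countable.union
      (Set.countable_iUnion fun p => (Place.finite_setOf _).countable)

/-- Pull-back of a place along a field embedding. -/
def Place.comap {k l : Type*} [Field k] [Field l] (f : k →+* l) (y : Place l) : Place k :=
  ⟨y.1.comp (f := f) f.injective, by
    have hf : ∀ q : ℚ, y.1.comp (f := f) f.injective (q : k) = y.1 (q : l) := fun q =>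
      congrArg y.1 (map_ratCast f q)
    simpa only [hf] using y.2⟩

/-- The place of the subfield `k` lying below the place `y` of `ℚ̄`. -/
def Place.restrict (k : IntermediateField ℚ Qbar) (y : Place Qbar) : Place k :=
  y.comap (algebraMap k Qbar)

/-- The action of `Aut(ℚ̄/ℚ)` on the places of `ℚ̄`, given by `‖x‖_{τy} = ‖τ⁻¹x‖_y`. -/
instance : MulAction GQ (Place Qbar) where
  smul τ y := y.comap ((τ⁻¹ : GQ) : Qbar →+* Qbar)
  one_smul _ := rfl
  mul_smul σ τ y := by
    apply Place.ext
    ext x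
    change y.1 ((σ * τ)⁻¹ x) = y.1 (τ⁻¹ (σ⁻¹ x))
    rw [mul_inv_rev]; rfl

theorem smul_apply (τ : GQ) (y : Place Qbar) (x : Qbar) : (τ • y).1 x = y.1 (τ⁻¹ x) := rfl

/-- The set `Y(k, v)` of the places of `ℚ̄` lying over the place `v` of `k`. -/
def placesOver (k : IntermediateField ℚ Qbar) (v : Place k) : Set (Place Qbar) :=
  {y | y.restrict k = v}

theorem mem_placesOver_iff {k : IntermediateField ℚ Qbar} {v : Place k} {y : Place Qbar} :
    y ∈ placesOver k v ↔ ∀ x : k, y.1 (x : Qbar) = v.1 x :=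
  ⟨fun h x => by rw [← show y.restrict k = v from h]; rfl,
    fun h => Place.ext (AbsoluteValue.ext h)⟩

/-- The sets `Y(k, v)`, where `k` is a number field inside `ℚ̄` and `v` is a place of `k`. -/
def basicOpens : Set (Set (Place Qbar)) :=
  {s | ∃ (k : IntermediateField ℚ Qbar) (_ : FiniteDimensional ℚ k) (v : Place k),
    s = placesOver k v}

/-- The topology of `Y = Place Qbar`: each `Y(k, v)` is open and carries the inverse limit topology of
the finite discrete sets of places of `l` above `v`, for `l` a finite extension of `k`. A basis of
this topology is formed by the sets `Y(l, w)`. -/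
instance : TopologicalSpace (Place Qbar) := TopologicalSpace.generateFrom basicOpens

/-- The Borel subsets of `Y`. -/
instance : MeasurableSpace (Place Qbar) := borel _

instance : BorelSpace (Place Qbar) := ⟨rfl⟩

theorem isOpen_placesOver (k : IntermediateField ℚ Qbar) [h : FiniteDimensional ℚ k]
    (v : Place k) : IsOpen (placesOver k v) :=
  TopologicalSpace.isOpen_generateFrom_of_mem ⟨k, h, v, rfl⟩

theorem countable_basicOpens : basicOpens.Countable := by
  have h1 : {k : IntermediateField ℚ Qbar | FiniteDimensional ℚ k}.Countable := by
    refine (Set.countable_range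
      (fun s : Finset Qbar => IntermediateField.adjoin ℚ (s : Set Qbar))).mono ?_
    intro k hk
    have : FiniteDimensional ℚ k := hk
    obtain ⟨s, hs⟩ := IntermediateField.essFiniteType_iff.1 (inferInstance : Algebra.EssFiniteType ℚ k)
    exact ⟨s, hs⟩
  have h2 : basicOpens ⊆ ⋃ k ∈ {k : IntermediateField ℚ Qbar | FiniteDimensional ℚ k},
      Set.range (placesOver k) := by
    rintro s ⟨k, hk, v, rfl⟩
    exact Set.mem_biUnion hk ⟨v, rfl⟩
  refine (h1.biUnion fun k hk => ?_).mono h2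
  have : FiniteDimensional ℚ k := hk
  have := Place.countable k
  exact Set.countable_range _

theorem borel_eq_generateFrom_basicOpens :
    borel (Place Qbar) = MeasurableSpace.generateFrom basicOpens := by
  have : SecondCountableTopology (Place Qbar) := ⟨basicOpens, countable_basicOpens, rfl⟩
  exact borel_eq_generateFrom_of_subbasis rfl

instance : MeasurableSpace GQ := borel _
instance : BorelSpace GQ := ⟨rfl⟩

theorem isOpen_setOf_eqOn (k : IntermediateField ℚ Qbar) [FiniteDimensional ℚ k] (σ : GQ) :
    IsOpen {τ : GQ | ∀ x : k, τ (x : Qbar) = σ x} := by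
  have h := k.fixingSubgroup_isOpen.preimage (continuous_const_mul σ⁻¹)
  convert h using 1
  ext τ
  simp only [Set.mem_ofPred_eq, Set.mem_preimage, SetLike.mem_coe,
    IntermediateField.mem_fixingSubgroup_iff, AlgEquiv.mul_apply, Subtype.forall]
  refine forall₂_congr fun x _ => ?_
  exact (AlgEquiv.symm_apply_eq σ).symm

/-- The map `(τ, y) ↦ τ⁻¹y` is jointly Borel measurable. -/
theorem measurable_inv_smul : Measurable fun p : GQ × Place Qbar => p.1⁻¹ • p.2 := by
  have hm : ∀ s ∈ basicOpens, MeasurableSet ((fun p : GQ × Place Qbar => p.1⁻¹ • p.2) ⁻¹' s) := by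
    rintro s ⟨k, hk, v, rfl⟩
    have hfin : Finite (k →ₐ[ℚ] Qbar) := inferInstance
    let A : (k →ₐ[ℚ] Qbar) → Set (GQ × Place Qbar) := fun e =>
      {τ : GQ | ∀ x : k, τ (x : Qbar) = e x} ×ˢ {y | ∀ x : k, y.1 (e x) = v.1 x}
    have hA : (fun p : GQ × Place Qbar => p.1⁻¹ • p.2) ⁻¹' placesOver k v = ⋃ e, A e := by
      ext ⟨τ, y⟩
      simp only [Set.mem_preimage, mem_placesOver_iff, smul_apply, inv_inv, Set.mem_iUnion]
      constructor
      · intro h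
        exact ⟨(τ : Qbar →ₐ[ℚ] Qbar).comp k.val, fun x => rfl, h⟩
      · rintro ⟨e, he, h⟩ x
        rw [he, h]
    rw [hA]
    refine MeasurableSet.iUnion fun e => ?_
    refine MeasurableSet.prod ?_ ?_
    · refine IsOpen.measurableSet ?_
      rcases Set.eq_empty_or_nonempty {τ : GQ | ∀ x : k, τ (x : Qbar) = e x} with h | ⟨σ, hσ⟩
      · rw [h]; exact isOpen_empty
      · simpa only [show ∀ x : k, σ x = e x from hσ] using isOpen_setOf_eqOn k σ
    · refine IsOpen.measurableSet ?_
      rcases Set.eq_empty_or_nonempty {y : Place Qbar | ∀ x : k, y.1 (e x) = v.1 x} with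
        h | ⟨z, hz⟩
      · rw [h]; exact isOpen_empty
      · have : FiniteDimensional ℚ e.fieldRange :=
          (AlgEquiv.ofInjectiveField e).toLinearEquiv.finiteDimensional
        convert isOpen_placesOver e.fieldRange (z.restrict e.fieldRange) using 1
        ext y
        rw [mem_placesOver_iff]
        constructor
        · rintro h ⟨_, x, rfl⟩
          exact (h x).trans (hz x).symm
        · intro h x
          exact (h ⟨e x, x, rfl⟩).trans (hz x)
  have h := measurable_generateFrom hm
  rw [← borel_eq_generateFrom_basicOpens] at h
  exact h

instance (K : IntermediateField ℚ Qbar) : CompactSpace K.fixingSubgroup :=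
  isCompact_iff_compactSpace.1 (InfiniteGalois.fixingSubgroup_isClosed K).isCompact

/-- The Haar measure of a compact group, normalised to have total mass `1`. -/
def haarProb (G : Type*) [Group G] [TopologicalSpace G] [IsTopologicalGroup G] [CompactSpace G]
    [MeasurableSpace G] [BorelSpace G] : Measure G :=
  Measure.haarMeasure ⊤

section haarProb

variable (G : Type*) [Group G] [TopologicalSpace G] [IsTopologicalGroup G] [CompactSpace G]
  [MeasurableSpace G] [BorelSpace G]

instance : IsProbabilityMeasure (haarProb G) := ⟨Measure.haarMeasure_self⟩

instance : (haarProb G).IsMulLeftInvariant :=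
  inferInstanceAs (Measure.haarMeasure ⊤).IsMulLeftInvariant

end haarProb

/-- The usual absolute value of `ℂ`. -/
def complexPlace : Place ℂ :=
  ⟨NormedField.toAbsoluteValue ℂ, Or.inl fun q => Complex.norm_ratCast q⟩

/-- The absolute value of the algebraic closure of `ℚ_p` that extends the `p`-adic one. -/
def padicPlace (p : ℕ) [hp : Fact p.Prime] : Place (PadicAlgCl p) :=
  ⟨NormedField.toAbsoluteValue (PadicAlgCl p), Or.inr ⟨p, hp.out, fun q => by
    have h : ((q : ℚ_[p]) : PadicAlgCl p) = (q : PadicAlgCl p) := map_ratCast _ q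
    change ‖(q : PadicAlgCl p)‖ = _
    rw [← h, PadicAlgCl.norm_extends, Padic.eq_padicNorm]⟩⟩

/-- A place of `ℚ̄` over each place of `ℚ`: over `∞` (`none`) through an embedding `ℚ̄ → ℂ`, over a
prime `p` (`some p`) through an embedding of `ℚ̄` in an algebraic closure of `ℚ_p`. -/
def basePlace : Option Nat.Primes → Place Qbar
  | none => complexPlace.comap ((IsAlgClosed.lift : Qbar →ₐ[ℚ] ℂ) : Qbar →+* ℂ)
  | some p =>
    haveI : Fact (p : ℕ).Prime := ⟨p.2⟩
    (padicPlace p).comap ((IsAlgClosed.lift : Qbar →ₐ[ℚ] PadicAlgCl p) : Qbar →+* PadicAlgCl p)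

/-- The normalised Galois invariant measure `λ` on the Borel subsets of `Y`. `Aut(ℚ̄/ℚ)` acts
transitively on the set `Y(ℚ, u)` of the places over each place `u` of `ℚ`, and `λ` restricted to
`Y(ℚ, u)` is the invariant measure of mass `1`, that is, the image of the normalised Haar measure under
`τ ↦ τ y_u` for any `y_u` in `Y(ℚ, u)`. If `k/ℚ` is finite Galois, then the Galois group permutes the
places `v ∣ u` of `k` transitively, so `λ(Y(k, v)) = 1 / #{v : v ∣ u} = [k_v : ℚ_u] / [k : ℚ]`. -/
def lam : Measure (Place Qbar) :=
  Measure.sum fun u : Option Nat.Primes => (haarProb GQ).map fun τ => τ • basePlace u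

theorem measurable_smul_right (y : Place Qbar) : Measurable fun τ : GQ => τ • y := by
  have h : Measurable fun τ : GQ => (τ⁻¹, y) := continuous_inv.measurable.prodMk measurable_const
  simpa [Function.comp_def] using measurable_inv_smul.comp h

theorem measurable_smul_left (σ : GQ) : Measurable fun y : Place Qbar => σ • y := by
  simpa [Function.comp_def] using
    measurable_inv_smul.comp (measurable_prodMk_left (x := σ⁻¹))

instance : SFinite lam := by unfold lam; infer_instance

/-- `λ(τE) = λ(E)` for all `τ` in `Aut(ℚ̄/ℚ)` and all Borel sets `E`. -/
theorem measurePreserving_smul (σ : GQ) : MeasurePreserving (fun y => σ • y) lam lam := by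
  refine ⟨measurable_smul_left σ, ?_⟩
  rw [lam, Measure.map_sum (measurable_smul_left σ).aemeasurable]
  congr 1
  funext u
  rw [Measure.map_map (measurable_smul_left σ) (measurable_smul_right _)]
  have h : ((fun y => σ • y) ∘ fun τ : GQ => τ • basePlace u) =
      (fun τ : GQ => τ • basePlace u) ∘ fun τ => σ * τ := by
    funext τ
    exact (mul_smul _ _ _).symm
  rw [h, ← Measure.map_map (measurable_smul_right _) (measurable_const_mul σ),
    map_mul_left_eq_self]

/-- The function `y ↦ ∫ F(τ⁻¹y) dν_K(τ)`, the integral being over `Aut(ℚ̄/K)` with respect to its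
normalised Haar measure `ν_K`. -/
def average (K : IntermediateField ℚ Qbar) (F : Place Qbar → ℝ) (y : Place Qbar) : ℝ :=
  ∫ τ : K.fixingSubgroup, F (τ⁻¹ • y) ∂haarProb K.fixingSubgroup

section average

variable (K : IntermediateField ℚ Qbar)

theorem measurable_inv_smul_fixingSubgroup :
    Measurable fun p : K.fixingSubgroup × Place Qbar => p.1⁻¹ • p.2 := by
  have h : Measurable fun p : K.fixingSubgroup × Place Qbar => ((p.1 : GQ), p.2) :=
    (measurable_subtype_coe.comp measurable_fst).prodMk measurable_snd
  have h' := measurable_inv_smul.comp h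
  exact h'

theorem measurePreserving_skew : MeasurePreserving
    (fun p : K.fixingSubgroup × Place Qbar => (p.1, p.1⁻¹ • p.2))
    ((haarProb K.fixingSubgroup).prod lam) ((haarProb K.fixingSubgroup).prod lam) :=
  (MeasurePreserving.id _).skew_product (g := fun τ y => τ⁻¹ • y)
    (measurable_inv_smul_fixingSubgroup K)
    (Filter.Eventually.of_forall fun τ => (measurePreserving_smul (τ⁻¹ : GQ)).map_eq)

theorem measurePreserving_inv_smul : MeasurePreserving
    (fun p : K.fixingSubgroup × Place Qbar => p.1⁻¹ • p.2)
    ((haarProb K.fixingSubgroup).prod lam) lam :=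
  measurePreserving_snd.comp (measurePreserving_skew K)

theorem integrable_inv_smul {F : Place Qbar → ℝ} (hF : Integrable F lam) :
    Integrable (fun p : K.fixingSubgroup × Place Qbar => F (p.1⁻¹ • p.2))
      ((haarProb K.fixingSubgroup).prod lam) :=
  (measurePreserving_inv_smul K).integrable_comp_of_integrable hF

theorem integrable_average {F : Place Qbar → ℝ} (hF : Integrable F lam) :
    Integrable (average K F) lam :=
  (integrable_inv_smul K hF).integral_prod_right

theorem integral_average {F : Place Qbar → ℝ} (hF : Integrable F lam) :
    ∫ y, average K F y ∂lam = ∫ y, F y ∂lam := by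
  have h1 := integral_prod _ (integrable_inv_smul K hF)
  have h2 := integral_prod_symm _ (integrable_inv_smul K hF)
  have h3 : ∀ τ : K.fixingSubgroup, ∫ y, F (τ⁻¹ • y) ∂lam = ∫ y, F y ∂lam := fun τ => by
    have h := measurePreserving_smul (τ⁻¹ : GQ)
    have hF' := hF.aestronglyMeasurable
    rw [← h.map_eq] at hF'
    have := integral_map h.measurable.aemeasurable hF'
    rw [h.map_eq] at this
    exact this.symm
  rw [h1] at h2
  simp only [h3, integral_const, probReal_univ, one_smul] at h2
  exact h2.symm

theorem average_congr {F G : Place Qbar → ℝ} (h : F =ᵐ[lam] G) :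
    average K F =ᵐ[lam] average K G := by
  have h1 := (measurePreserving_inv_smul K).quasiMeasurePreserving.ae h
  have h2 := Measure.ae_ae_of_ae_prod
    (Measure.measurePreserving_swap.quasiMeasurePreserving.ae h1)
  filter_upwards [h2] with y hy
  exact integral_congr_ae hy

theorem average_add {F G : Place Qbar → ℝ} (hF : Integrable F lam) (hG : Integrable G lam) :
    average K (F + G) =ᵐ[lam] average K F + average K G := by
  filter_upwards [(integrable_inv_smul K hF).prod_left_ae,
    (integrable_inv_smul K hG).prod_left_ae] with y h1 h2
  exact integral_add h1 h2

theorem average_smul (c : ℝ) (F : Place Qbar → ℝ) : average K (c • F) = c • average K F := by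
  funext y
  exact integral_const_mul c _

end average

/-- The real Banach space `L¹(Y, λ)`. -/
abbrev L1 : Type := Place Qbar →₁[lam] ℝ

/-- The Banach space `X = {F ∈ L¹(Y, λ) : ∫ F dλ = 0}`, with the `L¹`-norm. -/
def X : Submodule ℝ L1 where
  carrier := {F | ∫ y, F y ∂lam = 0}
  zero_mem' := by
    change ∫ y, (0 : L1) y ∂lam = 0
    rw [integral_congr_ae (Lp.coeFn_zero ℝ 1 lam)]
    simp
  add_mem' {F G} hF hG := by
    change ∫ y, F y ∂lam = 0 at hF
    change ∫ y, G y ∂lam = 0 at hG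
    change ∫ y, (F + G : L1) y ∂lam = 0
    rw [integral_congr_ae (Lp.coeFn_add F G)]
    simp only [Pi.add_apply]
    rw [integral_add (L1.integrable_coeFn F) (L1.integrable_coeFn G), hF, hG, add_zero]
  smul_mem' c F hF := by
    change ∫ y, F y ∂lam = 0 at hF
    change ∫ y, (c • F : L1) y ∂lam = 0
    rw [integral_congr_ae (Lp.coeFn_smul c F)]
    simp only [Pi.smul_apply]
    rw [integral_smul, hF, smul_zero]

theorem mem_X_iff (F : L1) : F ∈ X ↔ ∫ y, F y ∂lam = 0 := Iff.rfl

/-- The element of `X` that is represented by an integrable function with integral zero. -/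
def toX (F : Place Qbar → ℝ) (hF : Integrable F lam) (h0 : ∫ y, F y ∂lam = 0) : X :=
  ⟨hF.toL1 F, by rw [mem_X_iff, integral_congr_ae hF.coeFn_toL1, h0]⟩

theorem toX_congr {F G : Place Qbar → ℝ} {hF : Integrable F lam} {h0 : ∫ y, F y ∂lam = 0}
    {hG : Integrable G lam} {h0' : ∫ y, G y ∂lam = 0} (h : F =ᵐ[lam] G) :
    toX F hF h0 = toX G hG h0' :=
  Subtype.ext ((Integrable.toL1_eq_toL1_iff F G hF hG).2 h)

theorem toX_add {F G : Place Qbar → ℝ} (hF : Integrable F lam) (h0 : ∫ y, F y ∂lam = 0)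
    (hG : Integrable G lam) (h0' : ∫ y, G y ∂lam = 0) (h : Integrable (F + G) lam)
    (h0'' : ∫ y, (F + G) y ∂lam = 0) : toX (F + G) h h0'' = toX F hF h0 + toX G hG h0' :=
  Subtype.ext (Integrable.toL1_add F G hF hG)

theorem toX_smul (c : ℝ) {F : Place Qbar → ℝ} (hF : Integrable F lam) (h0 : ∫ y, F y ∂lam = 0)
    (h : Integrable (c • F) lam) (h0' : ∫ y, (c • F) y ∂lam = 0) :
    toX (c • F) h h0' = c • toX F hF h0 :=
  Subtype.ext (Integrable.toL1_smul F hF c)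

/-- The linear operator `U_K : X → X`, with `U_K(F)(y) = ∫ F(τ⁻¹y) dν_K(τ)` for almost all `y`,
the integral being over `Aut(ℚ̄/K)`. -/
def UProj (K : IntermediateField ℚ Qbar) : X →ₗ[ℝ] X where
  toFun F := toX (average K F.1) (integrable_average K (L1.integrable_coeFn F.1))
    ((integral_average K (L1.integrable_coeFn F.1)).trans F.2)
  map_add' F G := by
    have hF := L1.integrable_coeFn F.1
    have hG := L1.integrable_coeFn G.1
    have h : average K (F + G).1 =ᵐ[lam] average K F.1 + average K G.1 :=
      (average_congr K (Lp.coeFn_add F.1 G.1)).trans (average_add K hF hG)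
    have hi := (integrable_average K hF).add (integrable_average K hG)
    rw [← toX_add _ _ _ _ hi]
    · exact toX_congr h
    · rw [← integral_congr_ae h]
      exact (integral_average K (L1.integrable_coeFn (F + G).1)).trans (F + G).2
  map_smul' c F := by
    have hF := L1.integrable_coeFn F.1
    have h : average K (c • F).1 =ᵐ[lam] c • average K F.1 :=
      (average_congr K (Lp.coeFn_smul c F.1)).trans (by rw [average_smul])
    rw [RingHom.id_apply, ← toX_smul c _ _ ((integrable_average K hF).smul c)]
    · exact toX_congr h
    · rw [← integral_congr_ae h]
      exact (integral_average K (L1.integrable_coeFn (c • F).1)).trans (c • F).2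

/-- The function `f_α(y) = log ‖α‖_y` on `Y`. -/
def logAbs (α : Qbarˣ) (y : Place Qbar) : ℝ := Real.log (y.1 (α : Qbar))

theorem continuous_logAbs (α : Qbarˣ) : Continuous (logAbs α) := by
  refine continuous_def.2 fun s _ => isOpen_iff_forall_mem_open.2 fun y hy => ?_
  have hα : IsIntegral ℚ (α : Qbar) := (Algebra.IsAlgebraic.isAlgebraic _).isIntegral
  let k := IntermediateField.adjoin ℚ {(α : Qbar)}
  have : FiniteDimensional ℚ k := IntermediateField.adjoin.finiteDimensional hα
  refine ⟨placesOver k (y.restrict k), fun z hz => ?_, isOpen_placesOver _ _, rfl⟩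
  have h := mem_placesOver_iff.1 hz ⟨α, IntermediateField.mem_adjoin_simple_self ℚ _⟩
  have h' : logAbs α z = logAbs α y := congrArg Real.log h
  rwa [Set.mem_preimage, h']

theorem logAbs_mul (α β : Qbarˣ) : logAbs (α * β) = logAbs α + logAbs β := by
  funext y
  simp only [logAbs, Units.val_mul, map_mul, Pi.add_apply]
  exact Real.log_mul (y.1.ne_zero α.ne_zero) (y.1.ne_zero β.ne_zero)

theorem logAbs_smul (α : Qbarˣ) (τ : GQ) (y : Place Qbar) :
    logAbs α (τ • y) = Real.log (y.1 (τ⁻¹ (α : Qbar))) := rfl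

theorem basePlace_none_rat (q : ℚ) : (basePlace none).1 (q : Qbar) = |(q : ℝ)| := by
  let φ : Qbar →ₐ[ℚ] ℂ := IsAlgClosed.lift
  change ‖φ (q : Qbar)‖ = _
  rw [map_ratCast]
  exact Complex.norm_ratCast q

theorem basePlace_some_rat (p : Nat.Primes) (q : ℚ) :
    (basePlace (some p)).1 (q : Qbar) = ((padicNorm p q : ℚ) : ℝ) := by
  have : Fact (p : ℕ).Prime := ⟨p.2⟩
  let φ : Qbar →ₐ[ℚ] PadicAlgCl p := IsAlgClosed.lift
  have h : ((q : ℚ_[p]) : PadicAlgCl p) = (q : PadicAlgCl p) := map_ratCast _ q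
  change ‖φ (q : Qbar)‖ = _
  rw [map_ratCast, ← h, PadicAlgCl.norm_extends, Padic.eq_padicNorm]

theorem basePlace_le_one (p : Nat.Primes) {x : Qbar} (hx : IsIntegral ℤ x) :
    (basePlace (some p)).1 x ≤ 1 := by
  have : Fact (p : ℕ).Prime := ⟨p.2⟩
  let φ : Qbar →ₐ[ℚ] PadicAlgCl p := IsAlgClosed.lift
  let v := NormedField.valuation (K := PadicAlgCl p)
  have h1 : IsIntegral ℤ (φ x) := hx.map (φ : Qbar →+* PadicAlgCl p).toIntAlgHom
  have h2 : IsIntegral v.integer (φ x) := h1.tower_top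
  have h3 := (Valuation.integer.integers v).mem_of_integral h2
  exact h3

theorem finite_setOf_basePlace_ne_one (α : Qbarˣ) :
    ∃ S : Finset Nat.Primes, ∀ p ∉ S, ∀ τ : GQ,
      logAbs α (τ • basePlace (some p)) = 0 := by
  have hle : ∀ β : Qbarˣ, ∃ S : Finset Nat.Primes, ∀ p ∉ S, ∀ τ : GQ,
      (basePlace (some p)).1 (τ⁻¹ (β : Qbar)) ≤ 1 := by
    intro β
    have halg : IsAlgebraic ℤ (β : Qbar) :=
      (IsFractionRing.isAlgebraic_iff ℤ ℚ Qbar).2 (Algebra.IsAlgebraic.isAlgebraic _)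
    obtain ⟨d, hd, hint⟩ := halg.exists_integral_multiple
    have hfin : {p : Nat.Primes | (p : ℕ) ∣ d.natAbs}.Finite := by
      refine Set.Finite.of_finite_image (f := ((↑) : Nat.Primes → ℕ)) ?_
        (Subtype.val_injective.injOn)
      refine (Nat.divisors d.natAbs).finite_toSet.subset ?_
      rintro _ ⟨p, hp, rfl⟩
      exact Nat.mem_divisors.2 ⟨hp, by simpa using hd⟩
    refine ⟨hfin.toFinset, fun p hp τ => ?_⟩
    have hp' : ¬ (p : ℕ) ∣ d.natAbs := by simpa using hp
    have : Fact (p : ℕ).Prime := ⟨p.2⟩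
    have h1 : (basePlace (some p)).1 (d : Qbar) = 1 := by
      have h := basePlace_some_rat p d
      rw [Rat.cast_intCast] at h
      rw [h]
      exact_mod_cast padicNorm.int_eq_one_iff d |>.2 fun h => hp' (Int.natCast_dvd.1 h)
    have h2 := basePlace_le_one p (hint.map (τ⁻¹ : GQ).toRingHom.toIntAlgHom)
    have h3 : (τ⁻¹ : GQ).toRingHom.toIntAlgHom (d • (β : Qbar)) =
        (d : Qbar) * (τ⁻¹ : GQ) (β : Qbar) := by
      rw [zsmul_eq_mul]
      change (τ⁻¹ : GQ) _ = _
      rw [map_mul, map_intCast]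
    rw [h3, map_mul, h1, one_mul] at h2
    exact h2
  classical
  obtain ⟨S, hS⟩ := hle α
  obtain ⟨T, hT⟩ := hle α⁻¹
  refine ⟨S ∪ T, fun p hp τ => ?_⟩
  rw [Finset.mem_union, not_or] at hp
  have h1 := hS p hp.1 τ
  have h2 := hT p hp.2 τ
  have hpos : 0 < (basePlace (some p)).1 (τ⁻¹ (α : Qbar)) :=
    AbsoluteValue.pos _ (by simp)
  rw [Units.val_inv_eq_inv_val, map_inv₀, map_inv₀, inv_le_one₀ hpos] at h2
  rw [logAbs_smul, le_antisymm h1 h2, Real.log_one]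

theorem integrable_logAbs_smul (α : Qbarˣ) (y : Place Qbar) :
    Integrable (fun τ : GQ => logAbs α (τ • y)) (haarProb GQ) := by
  have hfin : (Set.range fun τ : GQ => logAbs α (τ • y)).Finite := by
    have h0 : (((minpoly ℚ (α : Qbar)).rootSet Qbar)).Finite := Polynomial.rootSet_finite _ _
    refine (h0.image fun x => Real.log (y.1 x)).subset ?_
    rintro _ ⟨τ, rfl⟩
    refine ⟨τ⁻¹ (α : Qbar), ?_, rfl⟩
    have hα : IsIntegral ℚ (α : Qbar) := (Algebra.IsAlgebraic.isAlgebraic _).isIntegral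
    rw [Polynomial.mem_rootSet]
    refine ⟨minpoly.ne_zero hα, ?_⟩
    exact (Polynomial.aeval_algHom_apply ((τ⁻¹ : GQ) : Qbar →ₐ[ℚ] Qbar) _ _).trans
      (by rw [minpoly.aeval, map_zero])
  obtain ⟨C, hC⟩ := hfin.isBounded.exists_norm_le
  refine Integrable.of_bound (C := C) ?_ (Filter.Eventually.of_forall fun τ => hC _ ⟨τ, rfl⟩)
  exact ((continuous_logAbs α).measurable.comp (measurable_smul_right y)).aestronglyMeasurable

theorem integrable_logAbs (α : Qbarˣ) : Integrable (logAbs α) lam := by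
  refine ⟨(continuous_logAbs α).measurable.aestronglyMeasurable, ?_⟩
  obtain ⟨S, hS⟩ := finite_setOf_basePlace_ne_one α
  have hterm : ∀ u, ∫⁻ y, ‖logAbs α y‖ₑ ∂((haarProb GQ).map fun τ => τ • basePlace u) =
      ∫⁻ τ, ‖logAbs α (τ • basePlace u)‖ₑ ∂(haarProb GQ) := fun u =>
    lintegral_map (continuous_logAbs α).measurable.enorm (measurable_smul_right _)
  rw [hasFiniteIntegral_iff_enorm, lam, lintegral_sum_measure]
  simp only [hterm]
  rw [tsum_eq_sum (s := insert none (S.map Function.Embedding.some))]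
  · exact ENNReal.sum_lt_top.2 fun u _ => (integrable_logAbs_smul α _).2
  · intro u hu
    obtain _ | p := u
    · simp at hu
    · have hp : p ∉ S := by simpa using hu
      simp [hS p hp]

/-- The product formula over `ℚ`. -/
theorem hasSum_log_rat (q : ℚ) (hq : q ≠ 0) :
    HasSum (fun u => Real.log ((basePlace u).1 (q : Qbar))) 0 := by
  have hmul : ∀ a b : ℚ, a ≠ 0 → b ≠ 0 →
      HasSum (fun u => Real.log ((basePlace u).1 (a : Qbar))) 0 →
      HasSum (fun u => Real.log ((basePlace u).1 (b : Qbar))) 0 →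
      HasSum (fun u => Real.log ((basePlace u).1 ((a * b : ℚ) : Qbar))) 0 := by
    intro a b ha hb h1 h2
    have h := h1.add h2
    rw [add_zero] at h
    convert h using 2 with u
    rw [Rat.cast_mul, map_mul, Real.log_mul]
    · exact AbsoluteValue.ne_zero _ (by exact_mod_cast ha)
    · exact AbsoluteValue.ne_zero _ (by exact_mod_cast hb)
  have hnat : ∀ n : ℕ, n ≠ 0 → HasSum (fun u => Real.log ((basePlace u).1 ((n : ℚ) : Qbar))) 0 := by
    intro n
    induction n using Nat.recOnMul with
    | zero => simp
    | one =>
      intro _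
      have h1 : (fun u => Real.log ((basePlace u).1 (((1 : ℕ) : ℚ) : Qbar))) = fun _ => 0 := by
        funext u; simp
      rw [h1]
      exact (hasSum_zero : HasSum (fun _ : Option Nat.Primes => (0 : ℝ)) 0)
    | prime ℓ hℓ =>
      intro _
      obtain ⟨P, rfl⟩ : ∃ P : Nat.Primes, (P : ℕ) = ℓ := ⟨⟨ℓ, hℓ⟩, rfl⟩
      have : Fact (P : ℕ).Prime := ⟨P.2⟩
      have hval : ∀ u ∉ ({none, some P} : Finset (Option Nat.Primes)),
          Real.log ((basePlace u).1 (((P : ℕ) : ℚ) : Qbar)) = 0 := by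
        intro u hu
        obtain _ | p := u
        · simp at hu
        · have hp : (p : ℕ) ≠ P := fun h => hu (by rw [Subtype.ext h]; simp)
          have : Fact (p : ℕ).Prime := ⟨p.2⟩
          rw [basePlace_some_rat, padicNorm.padicNorm_of_prime_of_ne hp]
          simp
      have h : HasSum (fun u => Real.log ((basePlace u).1 (((P : ℕ) : ℚ) : Qbar)))
          (∑ u ∈ ({none, some P} : Finset (Option Nat.Primes)),
            Real.log ((basePlace u).1 (((P : ℕ) : ℚ) : Qbar))) :=
        hasSum_sum_of_ne_finset_zero hval
      rw [Finset.sum_pair (by simp), basePlace_none_rat, basePlace_some_rat,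
        padicNorm.padicNorm_p_of_prime] at h
      simpa using h
    | mul a b iha ihb =>
      intro hab
      have ha := left_ne_zero_of_mul hab
      have hb := right_ne_zero_of_mul hab
      rw [Nat.cast_mul]
      exact hmul a b (by exact_mod_cast ha) (by exact_mod_cast hb) (iha ha) (ihb hb)
  have hden := hnat q.den q.den_ne_zero
  have hnum := hnat q.num.natAbs (by simpa using hq)
  have h := hnum.sub hden
  rw [sub_zero] at h
  have hfun : (fun u => Real.log ((basePlace u).1 (q : Qbar))) = fun u =>
      Real.log ((basePlace u).1 ((q.num.natAbs : ℚ) : Qbar)) -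
        Real.log ((basePlace u).1 ((q.den : ℚ) : Qbar)) := by
    funext u
    symm
    have h1 : (basePlace u).1 ((q.num.natAbs : ℚ) : Qbar) = (basePlace u).1 ((q.num : ℚ) : Qbar) := by
      rcases Int.natAbs_eq q.num with h | h
      · conv_rhs => rw [h]
        simp
      · conv_rhs => rw [h]
        simp
    rw [h1, ← Real.log_div, ← map_div₀, ← Rat.cast_div, Rat.num_div_den]
    · exact AbsoluteValue.ne_zero _ (by exact_mod_cast Rat.num_ne_zero.2 hq)
    · exact AbsoluteValue.ne_zero _ (by exact_mod_cast q.den_ne_zero)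
  rw [hfun]
  exact h

/-- The product formula. -/
theorem integral_logAbs (α : Qbarˣ) : ∫ y, logAbs α y ∂lam = 0 := by
  have hα : IsIntegral ℚ (α : Qbar) := (Algebra.IsAlgebraic.isAlgebraic _).isIntegral
  let k := IntermediateField.adjoin ℚ {(α : Qbar)}
  have : FiniteDimensional ℚ k := IntermediateField.adjoin.finiteDimensional hα
  let a : k := ⟨α, IntermediateField.mem_adjoin_simple_self ℚ _⟩
  have ha : a ≠ 0 := fun h => α.ne_zero (congrArg Subtype.val h)
  let q : ℚ := Algebra.norm ℚ a
  have hq : q ≠ 0 := (Algebra.norm_ne_zero_iff).2 ha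
  have hprod : (q : Qbar) = ∏ e : k →ₐ[ℚ] Qbar, e a := by
    rw [← Algebra.norm_eq_prod_embeddings ℚ Qbar a]; rfl
  have hlift : ∀ e : k →ₐ[ℚ] Qbar, ∃ σ : GQ, σ (α : Qbar) = e a := by
    intro e
    have h : IsConjRoot ℚ (e a) (α : Qbar) := by
      rw [IsConjRoot, minpoly.algHom_eq e e.injective]
      exact (minpoly.algHom_eq k.val k.val.injective a).symm
    obtain ⟨σ, hσ⟩ := h.exists_algEquiv
    exact ⟨σ, hσ⟩
  choose σ hσ using hlift
  let n : ℕ := Fintype.card (k →ₐ[ℚ] Qbar)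
  have hn : (n : ℝ) ≠ 0 := by
    have : Nonempty (k →ₐ[ℚ] Qbar) := ⟨k.val⟩
    exact_mod_cast Fintype.card_ne_zero
  have hterm : ∀ u, n * ∫ y, logAbs α y ∂((haarProb GQ).map fun τ => τ • basePlace u) =
      Real.log ((basePlace u).1 (q : Qbar)) := by
    intro u
    rw [integral_map (measurable_smul_right _).aemeasurable
      (continuous_logAbs α).measurable.aestronglyMeasurable]
    have h1 : ∀ e : k →ₐ[ℚ] Qbar, ∫ τ, logAbs α (τ • basePlace u) ∂(haarProb GQ) =
        ∫ τ, logAbs α (((σ e)⁻¹ * τ) • basePlace u) ∂(haarProb GQ) := fun e =>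
      (integral_mul_left_eq_self (μ := haarProb GQ)
        (fun τ => logAbs α (τ • basePlace u)) (σ e)⁻¹).symm
    have h2 : ∀ e : k →ₐ[ℚ] Qbar,
        Integrable (fun τ => logAbs α (((σ e)⁻¹ * τ) • basePlace u)) (haarProb GQ) := fun e =>
      (integrable_logAbs_smul α (basePlace u)).comp_mul_left (σ e)⁻¹
    calc (n : ℝ) * ∫ τ, logAbs α (τ • basePlace u) ∂(haarProb GQ)
        = ∑ e : k →ₐ[ℚ] Qbar, ∫ τ, logAbs α (((σ e)⁻¹ * τ) • basePlace u) ∂(haarProb GQ) := by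
          simp only [← h1, Finset.sum_const, Finset.card_univ, nsmul_eq_mul, n]
      _ = ∫ τ, ∑ e : k →ₐ[ℚ] Qbar, logAbs α (((σ e)⁻¹ * τ) • basePlace u) ∂(haarProb GQ) :=
          (integral_finsetSum _ fun e _ => h2 e).symm
      _ = ∫ τ : GQ, Real.log ((basePlace u).1 (q : Qbar)) ∂(haarProb GQ) := by
          refine integral_congr_ae (Filter.Eventually.of_forall fun τ => ?_)
          have h3 : ∀ e : k →ₐ[ℚ] Qbar, logAbs α (((σ e)⁻¹ * τ) • basePlace u) =
              Real.log ((basePlace u).1 (τ⁻¹ (e a))) := fun e => by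
            rw [logAbs_smul, mul_inv_rev, inv_inv, AlgEquiv.mul_apply, hσ]
          simp only [h3]
          rw [← Real.log_prod, ← map_prod, ← map_prod, ← hprod, map_ratCast]
          intro e _
          exact AbsoluteValue.ne_zero _ (by simpa using ha)
      _ = _ := by simp
  have hsum := hasSum_integral_measure (f := logAbs α) (integrable_logAbs α)
  have h := hsum.mul_left (n : ℝ)
  simp only [hterm] at h
  have := h.unique (hasSum_log_rat q hq)
  exact (mul_eq_zero.1 this).resolve_left hn

/-- The function `f_α`, as an element of `X`. -/
def heightVector (α : Qbarˣ) : X := toX (logAbs α) (integrable_logAbs α) (integral_logAbs α)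

theorem heightVector_mul (α β : Qbarˣ) :
    heightVector (α * β) = heightVector α + heightVector β :=
  (toX_congr (hG := (integrable_logAbs α).add (integrable_logAbs β))
    (h0' := by rw [← logAbs_mul]; exact integral_logAbs _)
    (Filter.EventuallyEq.of_eq (logAbs_mul α β))).trans (toX_add _ _ _ _ _ _)

theorem heightVector_one : heightVector 1 = 0 := by
  have h := heightVector_mul 1 1
  rwa [mul_one, left_eq_add] at h

theorem heightVector_zpow (α : Qbarˣ) (n : ℤ) : heightVector (α ^ n) = n • heightVector α := by
  exact map_zsmul (AddMonoidHom.mk' (fun β : Additive Qbarˣ => heightVector β.toMul)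
    fun a b => heightVector_mul _ _) n (Additive.ofMul α)

theorem exists_heightVector_eq_smul (c : ℚ) (α : Qbarˣ) :
    ∃ β : Qbarˣ, heightVector β = c • heightVector α := by
  obtain ⟨b, hb⟩ := IsAlgClosed.exists_pow_nat_eq ((α ^ c.num : Qbarˣ) : Qbar) c.den_pos
  have hb0 : b ≠ 0 := by
    rintro rfl
    rw [zero_pow c.den_ne_zero] at hb
    exact (α ^ c.num).ne_zero hb.symm
  refine ⟨Units.mk0 b hb0, ?_⟩
  have h : Units.mk0 b hb0 ^ (c.den : ℤ) = α ^ c.num := Units.ext (by simpa using hb)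
  have h2 := congrArg heightVector h
  rw [heightVector_zpow, heightVector_zpow] at h2
  have hd : (c.den : ℚ) ≠ 0 := by exact_mod_cast c.den_ne_zero
  have h3 : (c.den : ℚ) • heightVector (Units.mk0 b hb0) = (c.num : ℚ) • heightVector α := by
    rw [Int.cast_smul_eq_zsmul, ← h2, Nat.cast_smul_eq_nsmul, natCast_zsmul]
  rw [← inv_smul_smul₀ hd (heightVector (Units.mk0 b hb0)), h3, smul_smul]
  congr 1
  rw [mul_comm, ← div_eq_mul_inv, Rat.num_div_den]

/-- The `ℚ`-linear subspace `F = {f_α : α ∈ ℚ̄^×}` of `X`. (As `f_α` depends only on the class of `α`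
modulo torsion, it is the image of `ℚ̄^×/Tor(ℚ̄^×)`.) -/
def FSpace : Submodule ℚ X where
  carrier := Set.range heightVector
  zero_mem' := ⟨1, heightVector_one⟩
  add_mem' := by
    rintro _ _ ⟨α, rfl⟩ ⟨β, rfl⟩
    exact ⟨α * β, heightVector_mul α β⟩
  smul_mem' := by
    rintro c _ ⟨α, rfl⟩
    exact exists_heightVector_eq_smul c α

/-- The `ℚ`-linear span `D_K` of the functions `f_β` with `β ∈ K^×`. -/
def DSpace (K : IntermediateField ℚ Qbar) : Submodule ℚ X :=
  Submodule.span ℚ (heightVector '' {β : Qbarˣ | (β : Qbar) ∈ K})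

/-- The restriction `S_K` of `U_K` to `F`. -/
def SProj (K : IntermediateField ℚ Qbar) : FSpace →ₗ[ℚ] X :=
  ((UProj K).restrictScalars ℚ).comp FSpace.subtype

/-- The kernel `E_K = {f ∈ F : S_K(f) = 0}` of `S_K`, as a subspace of `X`. -/
def ESpace (K : IntermediateField ℚ Qbar) : Submodule ℚ X :=
  (LinearMap.ker (SProj K)).map FSpace.subtype

/-- A set `A` is `F`-closed if `A = F ∩ closure A`, with the closure taken in the `L¹`-norm of `X`. -/
def IsFClosed (A : Set X) : Prop := A = (FSpace : Set X) ∩ closure A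

/-- `L/k` is a (possibly infinite) Galois extension of subfields of `ℚ̄`. -/
def IsGaloisOver (k L : IntermediateField ℚ Qbar) : Prop :=
  ∃ h : k ≤ L, IsGalois k (IntermediateField.extendScalars h)

end

end WeilHeight

/-!
Every `f_α` has `U_K f_α = n⁻¹ f_β`, where `n = [K(α) : K]` and `β` is the norm of `α` from `K(α)`
to `K` (`average_logAbs`). So `U_K` maps `F` into `D_K`, it fixes `D_K` pointwise, and it restricts to
an idempotent endomorphism `P_K` of `F` (`SEnd K`) with image `D_K = ker (1 - P_K)` and kernel `E_K`;
it is continuous because averaging does not increase the `L¹`-norm.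

If `K₁ / (K₁ ∩ K₂)` is Galois, then `Aut(ℚ̄/K₂)` normalises `Aut(ℚ̄/K₁)`, and therefore preserves its
Haar measure under conjugation; by Fubini `P_{K₁}` and `P_{K₂}` commute (`SEnd_commute`).

Put `T_n = 1 - P_{K_n}` for `n ≤ M` and `T_n = P_{K_n}` for `n > M`. For commuting idempotents the sum
of the kernels is the kernel of the product (`iSup_ker_eq_ker_list_prod`). The subspace in question is
thus the kernel of the continuous endomorphism `T_1 ⋯ T_N` of `F`, which is closed in `F`.
-/

namespace WeilHeight

open MeasureTheory

/-! ### Kernels of products of commuting idempotents -/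

section Kernel

variable {R V ι : Type*} [CommRing R] [AddCommGroup V] [Module R V]

theorem ker_mul_of_idempotent {S T : Module.End R V} (hS : IsIdempotentElem S)
    (hST : Commute S T) : LinearMap.ker (S * T) = LinearMap.ker S ⊔ LinearMap.ker T := by
  apply le_antisymm
  · intro x hx
    have h1 : S (x - S x) = 0 := by
      have h := LinearMap.congr_fun hS x
      rw [map_sub, sub_eq_zero]
      exact h.symm
    have h2 : T (S x) = 0 := (LinearMap.congr_fun hST x).symm.trans hx
    rw [← sub_add_cancel x (S x)]
    exact Submodule.add_mem_sup h1 h2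
  · refine sup_le (fun x hx => ?_) fun x hx => ?_
    · rw [hST.eq, LinearMap.mem_ker, Module.End.mul_apply, LinearMap.mem_ker.1 hx, map_zero]
    · rw [LinearMap.mem_ker, Module.End.mul_apply, LinearMap.mem_ker.1 hx, map_zero]

/-- For commuting idempotents, the sum of the kernels is the kernel of the product. -/
theorem iSup_ker_eq_ker_list_prod (T : ι → Module.End R V) (hT : ∀ i, IsIdempotentElem (T i))
    (hc : ∀ i j, Commute (T i) (T j)) (l : List ι) :
    ⨆ i ∈ l, LinearMap.ker (T i) = LinearMap.ker (l.map T).prod := by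
  induction l with
  | nil => simp [Module.End.one_eq_id]
  | cons a l ih =>
    rw [List.map_cons, List.prod_cons, ker_mul_of_idempotent (hT a), ← ih]
    · simp [iSup_or, iSup_sup_eq]
    · refine Commute.list_prod_right _ _ fun S hS => ?_
      obtain ⟨i, -, rfl⟩ := List.mem_map.1 hS
      exact hc a i

theorem continuous_list_prod_end [TopologicalSpace V] (T : ι → Module.End R V)
    (hT : ∀ i, Continuous (T i)) (l : List ι) : Continuous (l.map T).prod := by
  induction l with
  | nil => exact continuous_id
  | cons a l ih => exact (hT a).comp ih

end Kernel

/-! ### Haar measure and conjugation -/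

instance (G : Type*) [Group G] [TopologicalSpace G] [IsTopologicalGroup G] [CompactSpace G]
    [MeasurableSpace G] [BorelSpace G] : (haarProb G).IsHaarMeasure :=
  inferInstanceAs (Measure.haarMeasure ⊤).IsHaarMeasure

/-- The Haar measure of a compact subgroup `H` is invariant under conjugation by the normaliser of
`H`. -/
theorem integral_haarProb_normalizer {G : Type*} [Group G] [TopologicalSpace G]
    [IsTopologicalGroup G] [MeasurableSpace G] [BorelSpace G] (H : Subgroup G) [CompactSpace H]
    {σ : G} (hσ : σ ∈ Subgroup.normalizer (H : Set G)) (h : G → ℝ) :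
    ∫ τ : H, h (σ * τ) ∂haarProb H = ∫ τ : H, h (τ * σ) ∂haarProb H := by
  have hmem : ∀ τ : H, σ * τ * σ⁻¹ ∈ H := fun τ => (Subgroup.mem_normalizer_iff.1 hσ τ).1 τ.2
  have hmem' : ∀ τ : H, σ⁻¹ * τ * σ ∈ H := fun τ => by
    rw [Subgroup.mem_normalizer_iff.1 hσ]
    simp [mul_assoc]
  let c : H ≃* H :=
    { toFun := fun τ => ⟨σ * τ * σ⁻¹, hmem τ⟩
      invFun := fun τ => ⟨σ⁻¹ * τ * σ, hmem' τ⟩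
      left_inv := fun τ => Subtype.ext (by simp [mul_assoc])
      right_inv := fun τ => Subtype.ext (by simp [mul_assoc])
      map_mul' := fun τ τ' => Subtype.ext (by simp [mul_assoc]) }
  have hc : Continuous c := Continuous.subtype_mk (by fun_prop) _
  have hc' : Continuous c.symm := Continuous.subtype_mk (by fun_prop) _
  let e : H ≃ₜ H := .mk c.toEquiv hc hc'
  have hmap : (haarProb H).map e = haarProb H := by
    have : ((haarProb H).map e).IsHaarMeasure :=
      Measure.isHaarMeasure_map_of_isFiniteMeasure (haarProb H) c.toMonoidHom hc c.surjective
    have : IsProbabilityMeasure ((haarProb H).map e) :=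
      Measure.isProbabilityMeasure_map hc.measurable.aemeasurable
    exact Measure.isHaarMeasure_eq_of_isProbabilityMeasure _ _
  have hint := e.toMeasurableEquiv.measurableEmbedding.integral_map (μ := haarProb H)
    fun τ : H => h (τ * σ)
  have hcoe : ⇑e.toMeasurableEquiv = e := rfl
  rw [hcoe, hmap] at hint
  rw [hint]
  refine integral_congr_ae (Filter.Eventually.of_forall fun τ => ?_)
  change h (σ * τ) = h (σ * τ * σ⁻¹ * σ)
  rw [inv_mul_cancel_right]

theorem integral_haarProb_mul_right {G : Type*} [Group G] [TopologicalSpace G]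
    [IsTopologicalGroup G] [MeasurableSpace G] [BorelSpace G] (H : Subgroup G) [CompactSpace H]
    (σ : H) (h : G → ℝ) :
    ∫ τ : H, h (τ * σ) ∂haarProb H = ∫ τ : H, h τ ∂haarProb H :=
  (integral_haarProb_normalizer H (Subgroup.le_normalizer σ.2) h).symm.trans
    (integral_mul_left_eq_self (μ := haarProb H) (fun τ : H => h τ) σ)

/-! ### Averages of the functions `f_α` -/

theorem measurable_logAbs (α : Qbarˣ) : Measurable (logAbs α) := (continuous_logAbs α).measurable

/-- `f_α` takes finitely many values on an orbit, as `α` has finitely many conjugates. -/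
theorem exists_norm_logAbs_smul_le (α : Qbarˣ) (y : Place Qbar) :
    ∃ C, ∀ τ : GQ, ‖logAbs α (τ • y)‖ ≤ C := by
  have hfin : (Set.range fun τ : GQ => logAbs α (τ • y)).Finite := by
    have h0 : (((minpoly ℚ (α : Qbar)).rootSet Qbar)).Finite := Polynomial.rootSet_finite _ _
    refine (h0.image fun x => Real.log (y.1 x)).subset ?_
    rintro _ ⟨τ, rfl⟩
    refine ⟨τ⁻¹ (α : Qbar), ?_, rfl⟩
    have hα : IsIntegral ℚ (α : Qbar) := (Algebra.IsAlgebraic.isAlgebraic _).isIntegral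
    rw [Polynomial.mem_rootSet]
    refine ⟨minpoly.ne_zero hα, ?_⟩
    exact (Polynomial.aeval_algHom_apply ((τ⁻¹ : GQ) : Qbar →ₐ[ℚ] Qbar) _ _).trans
      (by rw [minpoly.aeval, map_zero])
  obtain ⟨C, hC⟩ := hfin.isBounded.exists_norm_le
  exact ⟨C, fun τ => hC _ ⟨τ, rfl⟩⟩

variable (K : IntermediateField ℚ Qbar)

theorem integrable_logAbs_fixingSubgroup (α : Qbarˣ) (y : Place Qbar) (σ : GQ) :
    Integrable (fun τ : K.fixingSubgroup => logAbs α (((τ : GQ) * σ)⁻¹ • y))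
      (haarProb K.fixingSubgroup) := by
  obtain ⟨C, hC⟩ := exists_norm_logAbs_smul_le α y
  refine Integrable.of_bound (C := C) ?_ (Filter.Eventually.of_forall fun τ => hC _)
  have h : Measurable fun τ : K.fixingSubgroup => ((τ : GQ) * σ)⁻¹ :=
    ((continuous_subtype_val.mul continuous_const).inv).measurable
  exact ((measurable_logAbs α).comp ((measurable_smul_right y).comp h)).aestronglyMeasurable

theorem average_logAbs_of_mem {β : Qbarˣ} (hβ : (β : Qbar) ∈ K) :
    average K (logAbs β) = logAbs β := by
  funext y
  have h : ∀ τ : K.fixingSubgroup, logAbs β (τ⁻¹ • y) = logAbs β y := fun τ => by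
    change Real.log (y.1 ((τ : GQ)⁻¹⁻¹ (β : Qbar))) = _
    rw [inv_inv, (IntermediateField.mem_fixingSubgroup_iff K _).1 τ.2 _ hβ]
    rfl
  simp [average, h]

/-- The average of `f_α` over `Aut(ℚ̄/K)` is `[K(α) : K]⁻¹ f_β`, where `β` is the norm of `α` from
`K(α)` to `K`. -/
theorem average_logAbs (α : Qbarˣ) : ∃ (n : ℕ) (β : Qbarˣ), (β : Qbar) ∈ K ∧
    average K (logAbs α) = ((n : ℝ)⁻¹) • logAbs β := by
  have hα : IsIntegral K (α : Qbar) := (Algebra.IsAlgebraic.isAlgebraic (R := K) _).isIntegral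
  let E := IntermediateField.adjoin K {(α : Qbar)}
  have : FiniteDimensional K E := IntermediateField.adjoin.finiteDimensional hα
  let a : E := ⟨α, IntermediateField.mem_adjoin_simple_self K _⟩
  have ha : a ≠ 0 := fun h => α.ne_zero (congrArg Subtype.val h)
  let b : K := Algebra.norm K a
  have hb : (b : Qbar) ≠ 0 := fun h => (Algebra.norm_ne_zero_iff (R := K)).2 ha (Subtype.ext h)
  have hprod : (b : Qbar) = ∏ e : E →ₐ[K] Qbar, e a :=
    Algebra.norm_eq_prod_embeddings K Qbar a
  have hlift : ∀ e : E →ₐ[K] Qbar, ∃ σ : K.fixingSubgroup, (σ : GQ) (α : Qbar) = e a := by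
    intro e
    have h : IsConjRoot K (e a) (α : Qbar) := by
      rw [IsConjRoot, minpoly.algHom_eq e e.injective]
      exact (minpoly.algHom_eq E.val E.val.injective a).symm
    obtain ⟨σ, hσ⟩ := h.exists_algEquiv
    exact ⟨(IntermediateField.fixingSubgroupEquiv K).symm σ, hσ⟩
  -- The average is unchanged if `τ` is replaced by `τ * σ e`; summing over `e` gives the norm.
  choose σ hσ using hlift
  refine ⟨Fintype.card (E →ₐ[K] Qbar), Units.mk0 b hb, b.2, ?_⟩
  have hn : ((Fintype.card (E →ₐ[K] Qbar) : ℕ) : ℝ) ≠ 0 := by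
    have : Nonempty (E →ₐ[K] Qbar) := ⟨E.val⟩
    exact_mod_cast Fintype.card_ne_zero
  funext y
  rw [Pi.smul_apply, smul_eq_mul, eq_inv_mul_iff_mul_eq₀ hn]
  have h1 : ∀ e : E →ₐ[K] Qbar, average K (logAbs α) y =
      ∫ τ : K.fixingSubgroup, logAbs α (((τ : GQ) * σ e)⁻¹ • y) ∂haarProb K.fixingSubgroup :=
    fun e => (integral_haarProb_mul_right K.fixingSubgroup (σ e)
      fun τ => logAbs α (τ⁻¹ • y)).symm
  calc ((Fintype.card (E →ₐ[K] Qbar) : ℕ) : ℝ) * average K (logAbs α) y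
      = ∑ e : E →ₐ[K] Qbar, average K (logAbs α) y := by
        rw [Finset.sum_const, Finset.card_univ, nsmul_eq_mul]
    _ = ∑ e : E →ₐ[K] Qbar, ∫ τ : K.fixingSubgroup,
          logAbs α (((τ : GQ) * σ e)⁻¹ • y) ∂haarProb K.fixingSubgroup :=
        Finset.sum_congr rfl fun e _ => h1 e
    _ = ∫ τ : K.fixingSubgroup, ∑ e : E →ₐ[K] Qbar,
          logAbs α (((τ : GQ) * σ e)⁻¹ • y) ∂haarProb K.fixingSubgroup :=
        (integral_finsetSum _ fun e _ => integrable_logAbs_fixingSubgroup K α y (σ e)).symm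
    _ = average K (logAbs (Units.mk0 b hb)) y := by
        refine integral_congr_ae (Filter.Eventually.of_forall fun τ => ?_)
        have h3 : ∀ e : E →ₐ[K] Qbar, logAbs α (((τ : GQ) * σ e)⁻¹ • y) =
            Real.log (y.1 ((τ : GQ) (e a))) := fun e => by
          rw [logAbs_smul, inv_inv, AlgEquiv.mul_apply, hσ]
        have h4 : logAbs (Units.mk0 b hb) (τ⁻¹ • y) = Real.log (y.1 ((τ : GQ) (b : Qbar))) := by
          change Real.log (y.1 ((τ : GQ)⁻¹⁻¹ (b : Qbar))) = _
          rw [inv_inv]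
        simp only [h3, h4]
        rw [← Real.log_prod, ← map_prod, ← map_prod, ← hprod]
        intro e _
        exact AbsoluteValue.ne_zero _ (by simpa using ha)
    _ = logAbs (Units.mk0 b hb) y := by rw [average_logAbs_of_mem K (β := Units.mk0 b hb) b.2]

/-! ### Averages over normalising groups commute -/

/-- If `K₁ / (K₁ ∩ K₂)` is normal, the elements of `Aut(ℚ̄/K₂)` map `K₁` into itself, so they
normalise `Aut(ℚ̄/K₁)`. -/
theorem mem_normalizer_of_isGaloisOver {K₁ K₂ : IntermediateField ℚ Qbar}
    (h : IsGaloisOver (K₁ ⊓ K₂) K₁) {σ : GQ} (hσ : σ ∈ K₂.fixingSubgroup) :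
    σ ∈ Subgroup.normalizer (K₁.fixingSubgroup : Set GQ) := by
  obtain ⟨hle, hgal⟩ := h
  have hnorm := IntermediateField.normal_iff_forall_map_le'.1 hgal.to_normal
  have hmap : ∀ ρ ∈ K₂.fixingSubgroup, ∀ x ∈ K₁, (ρ : GQ) x ∈ K₁ := by
    intro ρ hρ x hx
    have hρ' : ρ ∈ (K₁ ⊓ K₂).fixingSubgroup :=
      IntermediateField.fixingSubgroup_antitone inf_le_right hρ
    exact hnorm (IntermediateField.fixingSubgroupEquiv _ ⟨ρ, hρ'⟩) ⟨x, hx, rfl⟩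
  have hconj : ∀ ρ ∈ K₂.fixingSubgroup, ∀ τ ∈ K₁.fixingSubgroup,
      ρ * τ * ρ⁻¹ ∈ K₁.fixingSubgroup := by
    intro ρ hρ τ hτ
    rw [IntermediateField.mem_fixingSubgroup_iff] at hτ ⊢
    intro x hx
    rw [AlgEquiv.mul_apply, AlgEquiv.mul_apply, hτ _ (hmap _ (inv_mem hρ) x hx)]
    exact AlgEquiv.apply_symm_apply ρ x
  rw [Subgroup.mem_normalizer_iff]
  refine fun τ => ⟨hconj σ hσ τ, fun hτ => ?_⟩
  have h := hconj _ (inv_mem hσ) _ hτ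
  simpa only [inv_inv, mul_assoc, inv_mul_cancel_left, inv_mul_cancel, mul_one] using h

/-- By invariance under conjugation, `σ⁻¹` can be moved past the average over `Aut(ℚ̄/K₁)` for each
`σ` in `Aut(ℚ̄/K₂)`; Fubini, for a bounded function, then exchanges the two averages. -/
theorem average_comm_logAbs {K₁ K₂ : IntermediateField ℚ Qbar}
    (h : IsGaloisOver (K₁ ⊓ K₂) K₁) (α : Qbarˣ) :
    average K₂ (average K₁ (logAbs α)) = average K₁ (average K₂ (logAbs α)) := by
  funext y
  obtain ⟨C, hC⟩ := exists_norm_logAbs_smul_le α y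
  have hmeas : Measurable fun p : K₂.fixingSubgroup × K₁.fixingSubgroup =>
      logAbs α (p.1⁻¹ • p.2⁻¹ • y) := by
    have h0 := measurable_inv_smul_fixingSubgroup K₁
    have h1 : Measurable fun p : K₂.fixingSubgroup × K₁.fixingSubgroup => (p.2, y) :=
      measurable_snd.prodMk measurable_const
    have h2 := (measurable_fst (α := K₂.fixingSubgroup)).prodMk (h0.comp h1)
    have h3 := (measurable_logAbs α).comp ((measurable_inv_smul_fixingSubgroup K₂).comp h2)
    exact h3
  have hint : Integrable (Function.uncurry
      fun (σ : K₂.fixingSubgroup) (τ : K₁.fixingSubgroup) => logAbs α (σ⁻¹ • τ⁻¹ • y))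
      ((haarProb K₂.fixingSubgroup).prod (haarProb K₁.fixingSubgroup)) := by
    refine Integrable.of_bound (C := C) hmeas.aestronglyMeasurable
      (Filter.Eventually.of_forall fun p => ?_)
    have h2 := hC ((p.1 : GQ)⁻¹ * (p.2 : GQ)⁻¹)
    rw [mul_smul] at h2
    exact h2
  have hswap : ∀ σ : K₂.fixingSubgroup,
      ∫ τ : K₁.fixingSubgroup, logAbs α (τ⁻¹ • σ⁻¹ • y) ∂haarProb K₁.fixingSubgroup =
      ∫ τ : K₁.fixingSubgroup, logAbs α (σ⁻¹ • τ⁻¹ • y) ∂haarProb K₁.fixingSubgroup := by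
    intro σ
    have h3 := integral_haarProb_normalizer K₁.fixingSubgroup
      (mem_normalizer_of_isGaloisOver h σ.2) fun ρ => logAbs α (ρ⁻¹ • y)
    simp only [mul_inv_rev, mul_smul] at h3
    exact h3
  calc average K₂ (average K₁ (logAbs α)) y
      = ∫ σ : K₂.fixingSubgroup, ∫ τ : K₁.fixingSubgroup, logAbs α (σ⁻¹ • τ⁻¹ • y)
          ∂haarProb K₁.fixingSubgroup ∂haarProb K₂.fixingSubgroup :=
        integral_congr_ae (Filter.Eventually.of_forall hswap)
    _ = average K₁ (average K₂ (logAbs α)) y := integral_integral_swap hint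

/-! ### The projections on `F` -/

theorem UProj_toX {F : Place Qbar → ℝ} (hF : Integrable F lam) (h0 : ∫ y, F y ∂lam = 0) :
    UProj K (toX F hF h0) = toX (average K F) (integrable_average K hF)
      ((integral_average K hF).trans h0) :=
  toX_congr (h0 := (integral_average K (L1.integrable_coeFn _)).trans (toX F hF h0).2)
    (average_congr K hF.coeFn_toL1)

theorem norm_UProj_le (F : X) : ‖UProj K F‖ ≤ ‖F‖ := by
  have hF := L1.integrable_coeFn F.1
  have h1 : ‖UProj K F‖ = ∫ y, ‖average K F.1 y‖ ∂lam :=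
    L1.norm_of_fun_eq_integral_norm (integrable_average K hF)
  have h2 : ‖F‖ = ∫ y, ‖F.1 y‖ ∂lam := L1.norm_eq_integral_norm F.1
  rw [h1, h2, ← integral_average K hF.norm]
  exact integral_mono (integrable_average K hF).norm (integrable_average K hF.norm)
    fun y => norm_integral_le_integral_norm _

theorem continuous_UProj : Continuous (UProj K) :=
  ((UProj K).mkContinuous 1 fun F => by rw [one_mul]; exact norm_UProj_le K F).continuous

theorem UProj_heightVector_of_mem {β : Qbarˣ} (hβ : (β : Qbar) ∈ K) :
    UProj K (heightVector β) = heightVector β :=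
  (UProj_toX K _ _).trans (toX_congr (.of_eq (average_logAbs_of_mem K hβ)))

theorem UProj_heightVector_mem_DSpace (α : Qbarˣ) : UProj K (heightVector α) ∈ DSpace K := by
  obtain ⟨n, β, hβ, h⟩ := average_logAbs K α
  have h1 : UProj K (heightVector α) = (n : ℝ)⁻¹ • heightVector β := by
    refine (UProj_toX K _ _).trans ((toX_congr (.of_eq h)).trans (toX_smul _ _ _ ?_ ?_))
    · exact (integrable_logAbs β).smul _
    · rw [← h]
      exact (integral_average K (integrable_logAbs α)).trans (integral_logAbs α)
  have h2 : (n : ℝ)⁻¹ • heightVector β = (n : ℚ)⁻¹ • heightVector β := by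
    rw [← Rat.cast_smul_eq_qsmul ℝ]
    push_cast
    rfl
  rw [h1, h2]
  exact Submodule.smul_mem _ _ (Submodule.subset_span ⟨β, hβ, rfl⟩)

theorem DSpace_le_FSpace : DSpace K ≤ FSpace := by
  refine Submodule.span_le.2 ?_
  rintro _ ⟨β, -, rfl⟩
  exact ⟨β, rfl⟩

theorem UProj_of_mem_DSpace {f : X} (hf : f ∈ DSpace K) : UProj K f = f := by
  have h : DSpace K ≤ LinearMap.eqLocus ((UProj K).restrictScalars ℚ) LinearMap.id := by
    refine Submodule.span_le.2 ?_
    rintro _ ⟨β, hβ, rfl⟩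
    exact UProj_heightVector_of_mem K hβ
  exact h hf

theorem SProj_mem_DSpace (f : FSpace) : SProj K f ∈ DSpace K := by
  obtain ⟨_, α, rfl⟩ := f
  exact UProj_heightVector_mem_DSpace K α

/-- The operator `S_K`, as an endomorphism of `F`. -/
noncomputable def SEnd : Module.End ℚ FSpace :=
  (SProj K).codRestrict FSpace fun f => DSpace_le_FSpace K (SProj_mem_DSpace K f)

theorem continuous_SEnd : Continuous (SEnd K) :=
  ((continuous_UProj K).comp continuous_subtype_val).subtype_mk _

theorem SEnd_isIdempotentElem : IsIdempotentElem (SEnd K) :=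
  LinearMap.ext fun f => Subtype.ext (UProj_of_mem_DSpace K (SProj_mem_DSpace K f))

theorem SEnd_commute_of_isGaloisOver {K₁ K₂ : IntermediateField ℚ Qbar}
    (h : IsGaloisOver (K₁ ⊓ K₂) K₁) : Commute (SEnd K₂) (SEnd K₁) := by
  refine LinearMap.ext fun f => Subtype.ext ?_
  obtain ⟨_, α, rfl⟩ := f
  change UProj K₂ (UProj K₁ (heightVector α)) = UProj K₁ (UProj K₂ (heightVector α))
  simp only [heightVector, UProj_toX]
  exact toX_congr (.of_eq (average_comm_logAbs h α))

theorem SEnd_commute {K₁ K₂ : IntermediateField ℚ Qbar}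
    (h : IsGaloisOver (K₁ ⊓ K₂) K₁ ∨ IsGaloisOver (K₁ ⊓ K₂) K₂) :
    Commute (SEnd K₁) (SEnd K₂) := by
  obtain h | h := h
  · exact (SEnd_commute_of_isGaloisOver h).symm
  · rw [inf_comm] at h
    exact SEnd_commute_of_isGaloisOver h

theorem ESpace_eq_map_ker : ESpace K = (LinearMap.ker (SEnd K)).map FSpace.subtype := by
  rw [ESpace, SEnd, LinearMap.ker_codRestrict]

theorem DSpace_eq_map_ker : DSpace K = (LinearMap.ker (1 - SEnd K)).map FSpace.subtype := by
  ext f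
  constructor
  · intro hf
    refine ⟨⟨f, DSpace_le_FSpace K hf⟩, ?_, rfl⟩
    exact sub_eq_zero.2 (Subtype.ext (UProj_of_mem_DSpace K hf).symm)
  · rintro ⟨g, hg, rfl⟩
    have h : g = SEnd K g := sub_eq_zero.1 hg
    rw [h]
    exact SProj_mem_DSpace K g

theorem isFClosed_map_subtype {B : Submodule ℚ FSpace} (hB : IsClosed (B : Set FSpace)) :
    IsFClosed ((B.map FSpace.subtype : Submodule ℚ X) : Set X) := by
  obtain ⟨C, hC, hCB⟩ := isClosed_induced_iff.1 hB
  have hsub : ((B.map FSpace.subtype : Submodule ℚ X) : Set X) ⊆ C := by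
    rintro _ ⟨f, hf, rfl⟩
    rw [← hCB] at hf
    exact hf
  refine Set.Subset.antisymm (Set.subset_inter ?_ subset_closure) ?_
  · rintro _ ⟨f, -, rfl⟩
    exact f.2
  · rintro f ⟨hf, hcl⟩
    have hmem : (⟨f, hf⟩ : FSpace) ∈ (B : Set FSpace) := by
      rw [← hCB]
      exact closure_minimal hsub hC hcl
    exact ⟨⟨f, hf⟩, hmem, rfl⟩

/-- The idempotent of `F` whose kernel is `D_K` if `b` holds and `E_K` otherwise. -/
noncomputable def complProj (b : Prop) [Decidable b] : Module.End ℚ FSpace :=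
  if b then 1 - SEnd K else SEnd K

section complProj

variable (b : Prop) [Decidable b]

theorem continuous_complProj : Continuous (complProj K b) := by
  unfold complProj
  split_ifs
  · exact continuous_id.sub (continuous_SEnd K)
  · exact continuous_SEnd K

theorem complProj_isIdempotentElem : IsIdempotentElem (complProj K b) := by
  unfold complProj
  split_ifs
  · exact IsIdempotentElem.one_sub (R := Module.End ℚ FSpace) (SEnd_isIdempotentElem K)
  · exact SEnd_isIdempotentElem K

theorem complProj_commute {K₁ K₂ : IntermediateField ℚ Qbar} (b' : Prop) [Decidable b']
    (h : Commute (SEnd K₁) (SEnd K₂)) : Commute (complProj K₁ b) (complProj K₂ b') := by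
  have h1 : ∀ T : Module.End ℚ FSpace, Commute (SEnd K₁) T → Commute (complProj K₁ b) T := by
    intro T hT
    unfold complProj
    split_ifs
    · exact Commute.sub_left (R := Module.End ℚ FSpace) (Commute.one_left T) hT
    · exact hT
  apply h1
  unfold complProj
  split_ifs
  · exact Commute.sub_right (R := Module.End ℚ FSpace) (Commute.one_right _) h
  · exact h

end complProj

end WeilHeight

theorem theorem8p1 (N : ℕ) (K : Fin N → IntermediateField ℚ WeilHeight.Qbar)
    (hK : ∀ i j : Fin N, i ≠ j →
      WeilHeight.IsGaloisOver (K i ⊓ K j) (K i) ∨ WeilHeight.IsGaloisOver (K i ⊓ K j) (K j))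
    (M : ℕ) (hM : M ≤ N) :
    WeilHeight.IsFClosed
      (((⨆ (n : Fin N) (_ : n.val < M), WeilHeight.DSpace (K n)) ⊔
        (⨆ (n : Fin N) (_ : M ≤ n.val), WeilHeight.ESpace (K n)) :
          Submodule ℚ WeilHeight.X) : Set WeilHeight.X) := by
  have hc : ∀ i j : Fin N, Commute (WeilHeight.complProj (K i) (i.val < M))
      (WeilHeight.complProj (K j) (j.val < M)) := by
    intro i j
    by_cases hij : i = j
    · subst hij
      exact Commute.refl _
    · exact WeilHeight.complProj_commute _ _ (WeilHeight.SEnd_commute (hK i j hij))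
  have hker := WeilHeight.iSup_ker_eq_ker_list_prod
    (fun i : Fin N => WeilHeight.complProj (K i) (i.val < M))
    (fun i => WeilHeight.complProj_isIdempotentElem _ _) hc (List.finRange N)
  have hcont := WeilHeight.continuous_list_prod_end
    (fun i : Fin N => WeilHeight.complProj (K i) (i.val < M))
    (fun i => WeilHeight.continuous_complProj _ _) (List.finRange N)
  have hclosed : IsClosed ((LinearMap.ker ((List.finRange N).map
      fun i => WeilHeight.complProj (K i) (i.val < M)).prod :
        Submodule ℚ WeilHeight.FSpace) : Set WeilHeight.FSpace) :=
    isClosed_singleton.preimage hcont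
  rw [← hker] at hclosed
  convert WeilHeight.isFClosed_map_subtype hclosed using 2
  simp only [List.mem_finRange, iSup_pos, Submodule.map_iSup]
  have hD : ∀ n : Fin N, n.val < M → WeilHeight.DSpace (K n) =
      (LinearMap.ker (WeilHeight.complProj (K n) (n.val < M))).map
        WeilHeight.FSpace.subtype := fun n hn => by
    rw [WeilHeight.complProj, if_pos hn, WeilHeight.DSpace_eq_map_ker]
  have hE : ∀ n : Fin N, M ≤ n.val → WeilHeight.ESpace (K n) =
      (LinearMap.ker (WeilHeight.complProj (K n) (n.val < M))).map
        WeilHeight.FSpace.subtype := fun n hn => by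
    rw [WeilHeight.complProj, if_neg hn.not_gt, WeilHeight.ESpace_eq_map_ker]
  apply le_antisymm
  · refine sup_le (iSup₂_le fun n hn => ?_) (iSup₂_le fun n hn => ?_)
    · rw [hD n hn]
      exact le_iSup (fun n : Fin N => (LinearMap.ker
        (WeilHeight.complProj (K n) (n.val < M))).map WeilHeight.FSpace.subtype) n
    · rw [hE n hn]
      exact le_iSup (fun n : Fin N => (LinearMap.ker
        (WeilHeight.complProj (K n) (n.val < M))).map WeilHeight.FSpace.subtype) n
  · refine iSup_le fun n => ?_
    obtain hn | hn := lt_or_ge n.val M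
    · rw [← hD n hn]
      exact le_sup_of_le_left (le_iSup₂_of_le n hn le_rfl)
    · rw [← hE n hn]
      exact le_sup_of_le_right (le_iSup₂_of_le n hn le_rfl)
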